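/- Let $k$ be a field of characteristic $0$. A variety is an integral separated scheme of finite type over $k$. Let $(X,D)$ be a reduced pair, that is, $X$ is a normal variety over $k$ and $D$ is a reduced Weil divisor on $X$ (all coefficients equal to $1$; $D=0$ is allowed), identified with its support, a closed subset of pure codimension one. A pair $(Y,C)$, with $C=\bigcup C_i$ a reduced divisor with irreducible components $C_i$, is snc if $Y$ is smooth over $k$, the $C_i$ are smooth and they meet transversally; that is, every point $p\in Y$ has local coordinates (a regular system of parameters of $\mathcal O_{Y,p}$) such that the components $C_i$ through $p$ are the zero loci at $p$ of pairwise distinct coordinates. The strata of $(Y,C)$ are the irreducible components of the intersections $\bigcap_{i\in I}C_i$ (including the empty intersection $Y$). Let $f\colon Y\to X$ be a proper birational morphism of varieties over $k$ with $Y$ smooth. Its exceptional locus $\mathrm{Ex}(f)\subset Y$ is the set of points at which $f$ is not a local isomorphism (no open neighbourhood is mapped isomorphically onto an open subscheme of $X$). Let $B=f^{-1}_*D$ be the birational transform: if $U\subset X$ is the largest open subset over which $f$ is an isomorphism, then $B$ is the closure in $Y$ of $f^{-1}(D\cap U)$. Suppose that $f\colon (Y,B)\to(X,D)$ is a log resolution: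 $(Y,B)$ is snc, $\mathrm{Ex}(f)$ is a divisor (possibly zero), and $(Y,B+\mathrm{Ex}(f))$ is snc. Then $f$ satisfies Condition 2 of thriftiness: $f$ is an isomorphism at the generic point of every stratum of $(Y,B)$; equivalently, no stratum of $(Y,B)$ is contained in $\mathrm{Ex}(f)$. -/

import Mathlib

open CategoryTheory AlgebraicGeometry

universe u

namespace SncPairs

/-- A variety over the field `k`: an integral, separated scheme of finite type over `k`. -/
structure IsVariety {k : Type u} [Field k] {X : Scheme.{u}} (s : X ⟶ Spec (.of k)) : Prop where
  isIntegral : IsIntegral X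
  isSeparated : IsSeparated s
  locallyOfFiniteType : LocallyOfFiniteType s
  quasiCompact : QuasiCompact s

/-- A scheme is normal if all its local rings are integrally closed domains. -/
def IsNormalScheme (X : Scheme.{u}) : Prop :=
  ∀ x : X, IsDomain (X.presheaf.stalk x) ∧ IsIntegrallyClosed (X.presheaf.stalk x)

/-- The irreducible components of a subset `S` of a topological space. -/
def componentsOf {T : Type*} [TopologicalSpace T] (S : Set T) : Set (Set T) :=
  {Z | Maximal (fun W : Set T => IsIrreducible W ∧ W ⊆ S) Z}

/-- A reduced Weil divisor (all coefficients equal to `1`), identified with its support: a closed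
subset all of whose irreducible components have codimension one. The zero divisor is `∅`. -/
structure IsReducedDivisor {X : Scheme.{u}} (D : Set X) : Prop where
  isClosed : IsClosed D
  codim_eq_one : ∀ Z ∈ componentsOf D, ∀ η : X, IsGenericPoint η Z → Order.coheight η = 1

/-- A reduced pair `(X, D)` over `k`: a normal variety with a reduced divisor. -/
structure IsReducedPair {k : Type u} [Field k] {X : Scheme.{u}} (s : X ⟶ Spec (.of k))
    (D : Set X) : Prop where
  isVariety : IsVariety s
  isNormal : IsNormalScheme X
  isReducedDivisor : IsReducedDivisor D

/-- The ideal of the (reduced) closed subset `Z` in the local ring of `X` at `p`: the germs at `p`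
that vanish at every point `η` of `Z` that specializes to `p`. -/
noncomputable def idealAt {X : Scheme.{u}} (Z : Set X) (p : X) : Ideal (X.presheaf.stalk p) :=
  ⨅ (η : X) (_ : η ∈ Z) (h : η ⤳ p),
    (IsLocalRing.maximalIdeal (X.presheaf.stalk η)).comap (X.presheaf.stalkSpecializes h).hom

/-- The family `x` is a system of local coordinates of `X` at `p`, i.e. a regular system of
parameters of the local ring: it generates the maximal ideal and its length is the dimension. -/
def IsLocalCoordinates {X : Scheme.{u}} (p : X) {n : ℕ} (x : Fin n → X.presheaf.stalk p) : Prop :=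
  Ideal.span (Set.range x) = IsLocalRing.maximalIdeal (X.presheaf.stalk p) ∧
    ringKrullDim (X.presheaf.stalk p) = n

/-- The pair `(X, D)`, with components `D_i` of `D`, has simple normal crossings: `X` is smooth
over `k`, and at every point `p` there are local coordinates such that the components `D_i`
through `p` are the zero loci of pairwise distinct coordinates (so that every `D_i` is smooth and
the `D_i` cross transversally). -/
structure IsSNC {k : Type u} [Field k] {X : Scheme.{u}} (s : X ⟶ Spec (.of k))
    (D : Set X) : Prop where
  smooth : Smooth s
  exists_coordinates : ∀ p : X, ∃ (n : ℕ) (x : Fin n → X.presheaf.stalk p),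
    IsLocalCoordinates p x ∧
      ∃ c : {Z : Set X // Z ∈ componentsOf D ∧ p ∈ Z} → Fin n, Function.Injective c ∧
        ∀ Z, idealAt Z.1 p = Ideal.span {x (c Z)}

/-- The strata of `(X, D)`: the irreducible components of the intersections of components of `D`
(the empty intersection being all of `X`). -/
def strata {X : Scheme.{u}} (D : Set X) : Set (Set X) :=
  {Z | ∃ C : Set (Set X), C ⊆ componentsOf D ∧ Z ∈ componentsOf (⋂₀ C)}

/-- The morphism `f` is birational: it restricts to an isomorphism between dense open
subschemes of the source and of the target. -/
def IsBirational {X Y : Scheme.{u}} (f : Y ⟶ X) : Prop :=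
  Scheme.BirationalOver f (𝟙 X)

/-- The morphism `f : Y ⟶ X` is an isomorphism at the point `y` of `Y`: it restricts to an
isomorphism from an open neighbourhood of `y` onto an open subscheme of `X`. -/
def IsIsoAt {X Y : Scheme.{u}} (f : Y ⟶ X) (y : Y) : Prop :=
  ∃ V : Y.Opens, y ∈ V ∧ IsOpenImmersion (V.ι ≫ f)

/-- The exceptional locus `Ex(f)`. -/
def exceptionalLocus {X Y : Scheme.{u}} (f : Y ⟶ X) : Set Y :=
  {y | ¬ IsIsoAt f y}

/-- The largest open subset of the target over which `f` is an isomorphism. -/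
noncomputable def isoLocus {X Y : Scheme.{u}} (f : Y ⟶ X) : X.Opens :=
  sSup {U | IsIso (f ∣_ U)}

/-- The birational transform of `D`: the closure in `Y` of the image of `D ∩ U` under the inverse
of `f` over `U`, where `U` is the largest open subset over which `f` is an isomorphism. -/
def birationalTransform {X Y : Scheme.{u}} (f : Y ⟶ X) (D : Set X) : Set Y :=
  closure (f ⁻¹' (D ∩ (isoLocus f : Set X)))

/-- `f : (Y, B) ⟶ (X, D)` is a resolution of pairs over `k`, where `B` is the birational transform
of `D`: a resolution of singularities such that `(Y, B)` is snc. -/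
structure IsResolution {k : Type u} [Field k] {X Y : Scheme.{u}} (sX : X ⟶ Spec (.of k))
    (sY : Y ⟶ Spec (.of k)) (f : Y ⟶ X) (D : Set X) : Prop where
  comp_eq : f ≫ sX = sY
  isVariety : IsVariety sY
  smooth : Smooth sY
  isProper : IsProper f
  isBirational : IsBirational f
  isSNC : IsSNC sY (birationalTransform f D)

/-- A (weak) log resolution: a resolution of pairs such that `Ex(f)` is a divisor and
`(Y, B + Ex(f))` is snc. -/
structure IsLogResolution {k : Type u} [Field k] {X Y : Scheme.{u}} (sX : X ⟶ Spec (.of k))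
    (sY : Y ⟶ Spec (.of k)) (f : Y ⟶ X) (D : Set X) : Prop
    extends IsResolution sX sY f D where
  isReducedDivisor_exceptionalLocus : IsReducedDivisor (exceptionalLocus f)
  isSNC_add : IsSNC sY (birationalTransform f D ∪ exceptionalLocus f)

/-- Condition 2 of thriftiness: `f` is an isomorphism at the generic point of every stratum of
`(Y, B)`, where `B` is the birational transform of `D`. -/
def SatisfiesCondition2 {X Y : Scheme.{u}} (f : Y ⟶ X) (D : Set X) : Prop :=
  ∀ Z ∈ strata (birationalTransform f D), ∀ η : Y, IsGenericPoint η Z → IsIsoAt f η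

end SncPairs

namespace SncPairs

open TopologicalSpace

/-! ### Irreducible components of closed sets -/

section Components

variable {T : Type*} [TopologicalSpace T]

/-! The proof is a dimension count at the generic point `η` of a stratum cut out by a set `C` of
components of `B`. By Krull's height theorem the local ring at `η` has dimension at most the number
of members of `C`, each being given there by one equation (`ringKrullDim_stalk_le_card`). If `η`
were exceptional, a component `W` of `Ex(f)` would pass through it. Then `W` and the members of `C`
would be distinct components of `B + Ex(f)` through `η`, and snc would assign them distinct
coordinates, one more than the dimension allows. For this count, components of `B` and of `Ex(f)`
must remain components of the union: the former have generic points over the isomorphism locus, and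
the latter have codimension one, so cannot lie properly inside a component of `B`. -/

lemma isClosed_of_mem_componentsOf {S Z : Set T} (hS : IsClosed S) (hZ : Z ∈ componentsOf S) :
    IsClosed Z := by
  have h := hZ.2 (y := closure Z) ⟨hZ.1.1.closure, closure_minimal hZ.1.2 hS⟩ subset_closure
  exact closure_eq_iff_isClosed.1 (h.antisymm subset_closure)

lemma exists_finset_isClosed_isIrreducible [NoetherianSpace T] {S : Set T} (hS : IsClosed S) :
    ∃ F : Finset (Set T), (∀ t ∈ F, IsClosed t) ∧ (∀ t ∈ F, IsIrreducible t) ∧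
      S = ⋃₀ (F : Set (Set T)) ∧ ∀ Z : Set T, IsIrreducible Z → Z ⊆ S → ∃ t ∈ F, Z ⊆ t := by
  obtain ⟨F, hF, hc, hi, hU⟩ := NoetherianSpace.exists_finite_set_isClosed_irreducible hS
  lift F to Finset (Set T) using hF
  exact ⟨F, hc, hi, hU, fun Z hZ hZS => isIrreducible_iff_sUnion_isClosed.1 hZ F hc (hU ▸ hZS)⟩

/-- An irreducible subset of a closed subset of a Noetherian space lies in a component. -/
lemma exists_mem_componentsOf_subset [NoetherianSpace T] {S Z : Set T} (hS : IsClosed S)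
    (hZ : IsIrreducible Z) (hZS : Z ⊆ S) : ∃ W ∈ componentsOf S, Z ⊆ W := by
  obtain ⟨F, -, hi, hU, hF⟩ := exists_finset_isClosed_isIrreducible hS
  obtain ⟨t, ht, hZt⟩ := hF Z hZ hZS
  obtain ⟨m, htm, hm⟩ := F.exists_le_maximal ht
  refine ⟨m, ⟨⟨hi m hm.1, hU ▸ Set.subset_sUnion_of_mem hm.1⟩, fun W hW hmW => ?_⟩, hZt.trans htm⟩
  obtain ⟨t', ht', hWt'⟩ := hF W hW.1 hW.2
  exact hWt'.trans (hm.2 ht' (hmW.trans hWt'))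

/-- Every component of the closure of `S` meets `S`. -/
lemma inter_nonempty_of_mem_componentsOf_closure [NoetherianSpace T] {S Z : Set T}
    (hZ : Z ∈ componentsOf (closure S)) : (Z ∩ S).Nonempty := by
  classical
  obtain ⟨F, hc, hi, hU, hF⟩ := exists_finset_isClosed_isIrreducible (isClosed_closure (s := S))
  have hsub : ∀ t ∈ F, Z ⊆ t → t = Z := fun t ht h =>
    (hZ.2 ⟨hi t ht, hU ▸ Set.subset_sUnion_of_mem ht⟩ h).antisymm h
  -- If `Z` missed `S`, the other members of `F` would cover `S`, hence its closure, and one of them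
  -- would contain `Z`.
  by_contra hne
  rw [Set.not_nonempty_iff_eq_empty] at hne
  have hcl : closure S ⊆ ⋃₀ ((F.erase Z : Finset (Set T)) : Set (Set T)) := by
    refine closure_minimal (fun s hs => ?_) ?_
    · obtain ⟨t, ht, hst⟩ := hU ▸ subset_closure hs
      refine ⟨t, ?_, hst⟩
      rw [Finset.mem_coe, Finset.mem_erase]
      refine ⟨?_, ht⟩
      rintro rfl
      exact Set.notMem_empty s (hne ▸ ⟨hst, hs⟩)
    · rw [Set.sUnion_eq_biUnion]
      exact (F.erase Z).finite_toSet.isClosed_biUnion fun t ht => hc t (Finset.mem_of_mem_erase ht)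
  obtain ⟨t, ht, hZt⟩ := isIrreducible_iff_sUnion_isClosed.1 hZ.1.1 (F.erase Z)
    (fun t ht => hc t (Finset.mem_of_mem_erase ht)) (hZ.1.2.trans hcl)
  exact Finset.ne_of_mem_erase ht (hsub t (Finset.mem_of_mem_erase ht) hZt)

lemma mem_componentsOf_union {A B Z : Set T} (hA : IsClosed A) (hB : IsClosed B)
    (hZ : Z ∈ componentsOf A) (h : ¬ Z ⊆ B) : Z ∈ componentsOf (A ∪ B) := by
  refine ⟨⟨hZ.1.1, hZ.1.2.trans Set.subset_union_left⟩, fun W hW hZW => ?_⟩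
  rcases (isPreirreducible_iff_isClosed_union_isClosed.1 hW.1.2) A B hA hB hW.2 with h' | h'
  · exact hZ.2 ⟨hW.1, h'⟩ hZW
  · exact absurd (hZW.trans h') h

end Components

/-! ### Krull's height theorem at the generic point of a stratum -/

section LocalRings

variable {X : Scheme.{u}}

lemma fromSpecStalk_SpecMap_closedPoint {x y : X} (h : x ⤳ y) :
    X.fromSpecStalk y (Spec.map (X.presheaf.stalkSpecializes h)
      (IsLocalRing.closedPoint (X.presheaf.stalk x))) = x :=
  (Scheme.Hom.comp_apply _ _ _).symm.trans <|
    (congrArg (fun g : Spec (X.presheaf.stalk x) ⟶ X =>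
      g (IsLocalRing.closedPoint (X.presheaf.stalk x)))
      (Scheme.SpecMap_stalkSpecializes_fromSpecStalk h)).trans Scheme.fromSpecStalk_closedPoint

/-- The ideal of an irreducible closed subset is the prime corresponding to its generic point:
every prime containing it corresponds to a point of the subset. -/
lemma fromSpecStalk_mem_of_idealAt_le {Z : Set X} (hZ : IsClosed Z) (hi : IsIrreducible Z) {p : X}
    (hp : p ∈ Z) (q : Spec (X.presheaf.stalk p)) (hq : idealAt Z p ≤ q.asIdeal) :
    X.fromSpecStalk p q ∈ Z := by
  obtain ⟨t, ht⟩ := QuasiSober.sober hi hZ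
  have htp : t ⤳ p := ht.specializes hp
  let P : Spec (X.presheaf.stalk p) :=
    Spec.map (X.presheaf.stalkSpecializes htp) (IsLocalRing.closedPoint (X.presheaf.stalk t))
  have hP : X.fromSpecStalk p P = t := fromSpecStalk_SpecMap_closedPoint htp
  -- Every point of `Z` is a specialization of `t`, so its prime contains `P`.
  have hle : P.asIdeal ≤ idealAt Z p := by
    refine le_iInf fun ζ => le_iInf fun hζ => le_iInf fun hζp => ?_
    have htζ : t ⤳ ζ := ht.specializes hζ
    let Q : Spec (X.presheaf.stalk p) :=
      Spec.map (X.presheaf.stalkSpecializes hζp) (IsLocalRing.closedPoint (X.presheaf.stalk ζ))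
    have hQ : X.fromSpecStalk p Q = ζ := fromSpecStalk_SpecMap_closedPoint hζp
    have hPQ : P ⤳ Q := by
      rw [← (X.fromSpecStalk p).isEmbedding.isInducing.specializes_iff, hP, hQ]
      exact htζ
    exact (PrimeSpectrum.le_iff_specializes P Q).2 hPQ
  have hPq : P ⤳ q := (PrimeSpectrum.le_iff_specializes P q).1 (hle.trans hq)
  have h := hPq.map (X.fromSpecStalk p).continuous
  rw [hP] at h
  exact h.mem_closed hZ ht.mem

/-- If `η` is the generic point of a component of an intersection of irreducible closed subsets
which are defined at `η` by a single equation each, then the dimension of the local ring at `η` is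
at most the number of these subsets. -/
lemma ringKrullDim_stalk_le_card [IsLocallyNoetherian X] {ι : Type*} [Finite ι] (V : ι → Set X)
    (hc : ∀ i, IsClosed (V i)) (hi : ∀ i, IsIrreducible (V i)) {Z : Set X}
    (hZ : Z ∈ componentsOf (⋂ i, V i)) {η : X} (hη : IsGenericPoint η Z)
    (g : ι → X.presheaf.stalk η) (hg : ∀ i, idealAt (V i) η = Ideal.span {g i}) :
    ringKrullDim (X.presheaf.stalk η) ≤ Nat.card ι := by
  have hmem : ∀ i, η ∈ V i := fun i => Set.mem_iInter.1 (hZ.1.2 hη.mem) i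
  -- A prime containing all the equations is a generization of `η` lying in every `V i`; maximality
  -- of `Z` forces it to be `η`. So the maximal ideal is minimal over the equations.
  have hgen : ∀ q : Spec (X.presheaf.stalk η), Set.range g ⊆ q.asIdeal →
      q = IsLocalRing.closedPoint (X.presheaf.stalk η) := by
    intro q hq
    apply (X.fromSpecStalk η).isEmbedding.injective
    rw [Scheme.fromSpecStalk_closedPoint]
    set ζ := X.fromSpecStalk η q
    have hζV : ∀ i, ζ ∈ V i := fun i =>
      fromSpecStalk_mem_of_idealAt_le (hc i) (hi i) (hmem i) q (by
        rw [hg i, Ideal.span_le, Set.singleton_subset_iff]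
        exact hq ⟨i, rfl⟩)
    have hζη : ζ ⤳ η := by
      have : ζ ∈ Set.range (X.fromSpecStalk η) := ⟨q, rfl⟩
      rwa [Scheme.range_fromSpecStalk] at this
    have hsub : closure {ζ} ⊆ Z := hZ.2 ⟨isIrreducible_singleton.closure,
      closure_minimal (Set.singleton_subset_iff.2 (Set.mem_iInter.2 hζV)) (isClosed_iInter hc)⟩
      (by rw [← hη.def]; exact hζη.closure_subset)
    exact (hζη.antisymm (hη.specializes (hsub (subset_closure rfl)))).eq
  have hmin : IsLocalRing.maximalIdeal (X.presheaf.stalk η) ∈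
      (Ideal.span (Set.range g)).minimalPrimes := by
    refine ⟨⟨inferInstance, ?_⟩, fun q hq _ => ?_⟩
    · rw [Ideal.span_le]
      rintro _ ⟨i, rfl⟩
      have h : g i ∈ idealAt (V i) η := hg i ▸ Ideal.mem_span_singleton_self _
      have h1 := iInf_le_of_le (a := (IsLocalRing.maximalIdeal (X.presheaf.stalk η)).comap
        (X.presheaf.stalkSpecializes (specializes_refl η)).hom) η
          (iInf_le_of_le (hmem i) (iInf_le _ (specializes_refl η))) h
      simpa using h1
    · have := hgen ⟨q, hq.1⟩ (Ideal.span_le.1 hq.2)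
      exact (congrArg PrimeSpectrum.asIdeal this).ge
  rw [← IsLocalRing.maximalIdeal_height_eq_ringKrullDim]
  have h := Ideal.height_le_card_of_mem_minimalPrimes_span (Set.finite_range g) hmin
  have h2 : (Set.range g).ncard ≤ Nat.card ι := by
    rw [← Set.image_univ, ← Set.ncard_univ]
    exact Set.ncard_image_le Set.finite_univ
  exact_mod_cast h.trans (Nat.cast_le.2 h2)

end LocalRings

/-! ### Birational transform versus exceptional locus -/

section Morphisms

variable {X Y : Scheme.{u}} (f : Y ⟶ X)

lemma isClosed_exceptionalLocus : IsClosed (exceptionalLocus f) := by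
  rw [← isOpen_compl_iff, isOpen_iff_forall_mem_open]
  intro y hy
  obtain ⟨V, hyV, hV⟩ := not_not.1 hy
  exact ⟨V, fun z hz h => h ⟨V, hz, hV⟩, V.isOpen, hyV⟩

variable {f}

lemma exists_isIso_of_mem_isoLocus {x : X} (hx : x ∈ isoLocus f) :
    ∃ U : X.Opens, IsIso (f ∣_ U) ∧ x ∈ U := by
  simpa [isoLocus] using hx

lemma isIsoAt_of_mem_isoLocus {y : Y} (hy : f y ∈ isoLocus f) : IsIsoAt f y := by
  obtain ⟨U, hU, hyU⟩ := exists_isIso_of_mem_isoLocus hy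
  refine ⟨f ⁻¹ᵁ U, hyU, ?_⟩
  rw [← morphismRestrict_ι]
  infer_instance

lemma subset_range_of_isIso {U : X.Opens} (hU : IsIso (f ∣_ U)) : (U : Set X) ⊆ Set.range f := by
  intro x hx
  obtain ⟨y, hy⟩ := (f ∣_ U).surjective ⟨x, hx⟩
  refine ⟨(f ⁻¹ᵁ U).ι y, ?_⟩
  rw [← Scheme.Hom.comp_apply, ← morphismRestrict_ι, Scheme.Hom.comp_apply, hy]
  rfl

variable {D : Set X}

/-- The components of the birational transform of `D` are not exceptional. -/
lemma genericPoint_mem_isoLocus [NoetherianSpace Y] {Z : Set Y}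
    (hZ : Z ∈ componentsOf (birationalTransform f D)) {t : Y} (ht : IsGenericPoint t Z) :
    f t ∈ isoLocus f := by
  obtain ⟨y, hyZ, hy⟩ := inter_nonempty_of_mem_componentsOf_closure hZ
  exact (ht.specializes hyZ).mem_open ((isoLocus f).isOpen.preimage f.continuous) hy.2

lemma not_subset_exceptionalLocus [NoetherianSpace Y] {Z : Set Y}
    (hZ : Z ∈ componentsOf (birationalTransform f D)) : ¬ Z ⊆ exceptionalLocus f := by
  obtain ⟨t, ht⟩ := QuasiSober.sober hZ.1.1 (isClosed_of_mem_componentsOf isClosed_closure hZ)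
  exact fun h => h ht.mem (isIsoAt_of_mem_isoLocus (genericPoint_mem_isoLocus hZ ht))

/-- Otherwise `t` is generic in `Y`, so `f` maps all of `Y` into `D`. Then `D` contains a nonempty
open set, hence is all of `X`, whose generic point has codimension zero, not one. -/
lemma coheight_ne_zero_of_mem_componentsOf [NoetherianSpace Y] [IrreducibleSpace X]
    [IrreducibleSpace Y] (hD : IsReducedDivisor D) {Z : Set Y}
    (hZ : Z ∈ componentsOf (birationalTransform f D)) {t : Y} (ht : IsGenericPoint t Z) :
    Order.coheight t ≠ 0 := by
  rw [Order.coheight_ne_zero]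
  intro hmax
  have htop : ∀ y : Y, t ⤳ y := by
    intro y
    have h : genericPoint Y ⤳ t := genericPoint_specializes t
    exact Specializes.trans (hmax h) (genericPoint_specializes y)
  have htD : f t ∈ D :=
    closure_minimal (Set.preimage_mono Set.inter_subset_left)
      (hD.isClosed.preimage f.continuous) (hZ.1.2 ht.mem)
  obtain ⟨U, hU, htU⟩ := exists_isIso_of_mem_isoLocus (genericPoint_mem_isoLocus hZ ht)
  have hUD : (U : Set X) ⊆ D := by
    intro x hx
    obtain ⟨y, rfl⟩ := subset_range_of_isIso hU hx
    exact ((htop y).map f.continuous).mem_closed hD.isClosed htD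
  have hDuniv : D = Set.univ := by
    rw [← Set.univ_subset_iff, ← (U.isOpen.dense ⟨_, htU⟩).closure_eq]
    exact closure_minimal hUD hD.isClosed
  have h1 := hD.codim_eq_one Set.univ
    ⟨⟨IrreducibleSpace.isIrreducible_univ X, hDuniv.ge⟩, fun _ _ _ => Set.subset_univ _⟩
    (genericPoint X) (genericPoint_spec X)
  have h0 : Order.coheight (genericPoint X) = 0 :=
    Order.coheight_eq_zero.2 fun x _ => genericPoint_specializes x
  exact zero_ne_one (h0.symm.trans h1)

/-- If the exceptional locus is a divisor, its components are components of its union with the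
birational transform. -/
lemma mem_componentsOf_birationalTransform_union [NoetherianSpace Y] [IrreducibleSpace X]
    [IrreducibleSpace Y] (hD : IsReducedDivisor D) (hE : IsReducedDivisor (exceptionalLocus f))
    {W : Set Y} (hW : W ∈ componentsOf (exceptionalLocus f)) :
    W ∈ componentsOf (birationalTransform f D ∪ exceptionalLocus f) := by
  rw [Set.union_comm]
  refine mem_componentsOf_union hE.isClosed isClosed_closure hW fun hWB => ?_
  obtain ⟨Z, hZ, hWZ⟩ := exists_mem_componentsOf_subset isClosed_closure hW.1.1 hWB
  have hWc := isClosed_of_mem_componentsOf hE.isClosed hW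
  obtain ⟨w, hw⟩ := QuasiSober.sober hW.1.1 hWc
  obtain ⟨t, ht⟩ := QuasiSober.sober hZ.1.1 (isClosed_of_mem_componentsOf isClosed_closure hZ)
  -- Larger points are more generic, so `coheight` is codimension. The inequality is strict because
  -- `w` is exceptional and `t` is not; as `w` has codimension one, `t` has codimension zero.
  have hlt : w < t := by
    refine ⟨ht.specializes (hWZ hw.mem), fun h => ?_⟩
    exact hW.1.2 ((show w ⤳ t from h).mem_closed hWc hw.mem)
      (isIsoAt_of_mem_isoLocus (genericPoint_mem_isoLocus hZ ht))
  have h := Order.coheight_add_one_le hlt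
  rw [hE.codim_eq_one W hW w hw] at h
  have h0 : Order.coheight t + 1 ≤ 0 + 1 := by simpa using h
  exact coheight_ne_zero_of_mem_componentsOf hD hZ ht
    (nonpos_iff_eq_zero.1 ((ENat.add_le_add_iff_right ENat.one_ne_top).1 h0))

/-- If the exceptional locus is a divisor which crosses the birational transform of `D` normally,
then `f` is an isomorphism at the generic points of the strata of the latter. -/
lemma satisfiesCondition2_of_isSNC [IsLocallyNoetherian Y] [NoetherianSpace Y]
    [IrreducibleSpace X] [IrreducibleSpace Y] {k : Type u} [Field k] {sY : Y ⟶ Spec (.of k)}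
    (hD : IsReducedDivisor D) (hE : IsReducedDivisor (exceptionalLocus f))
    (hsnc : IsSNC sY (birationalTransform f D ∪ exceptionalLocus f)) :
    SatisfiesCondition2 f D := by
  rintro Z ⟨C, hC, hZ⟩ η hη
  by_contra hηE
  obtain ⟨W, hW, hηW⟩ := exists_mem_componentsOf_subset hE.isClosed
    (isIrreducible_singleton (x := η)) (Set.singleton_subset_iff.2 hηE)
  rw [Set.singleton_subset_iff] at hηW
  obtain ⟨n, x, hx, c, hc, hcx⟩ := hsnc.exists_coordinates η
  have hηC : ∀ V ∈ C, η ∈ V := fun V hV => hZ.1.2 hη.mem V hV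
  -- The value at `none` is the exceptional component: it supplies the extra coordinate that
  -- contradicts the height bound.
  let e : Option C → {V : Set Y //
      V ∈ componentsOf (birationalTransform f D ∪ exceptionalLocus f) ∧ η ∈ V}
    | none => ⟨W, mem_componentsOf_birationalTransform_union hD hE hW, hηW⟩
    | some V => ⟨V, mem_componentsOf_union isClosed_closure hE.isClosed (hC V.2)
        (not_subset_exceptionalLocus (hC V.2)), hηC V V.2⟩
  have hWC : ∀ V : C, V.1 ≠ W := fun V h =>
    not_subset_exceptionalLocus (hC V.2) (h ▸ hW.1.2)
  have he : Function.Injective e := by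
    rintro (_ | V) (_ | V') h
    · rfl
    · exact absurd (congrArg Subtype.val h).symm (hWC V')
    · exact absurd (congrArg Subtype.val h) (hWC V)
    · have hV : (e (some V)).1 = (e (some V')).1 := congrArg Subtype.val h
      exact congrArg some (Subtype.ext hV)
  have hinj := hc.comp he
  -- Finiteness of `C` comes from the injection into the finite set of coordinates.
  have : Finite (Option C) := Finite.of_injective _ hinj
  have : Finite C := Finite.of_injective _ (Option.some_injective C)
  have hcard : Nat.card C + 1 ≤ n := by
    simpa [Finite.card_option] using Nat.card_le_card_of_injective _ hinj
  have hdim := ringKrullDim_stalk_le_card (fun V : C => V.1)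
    (fun V => isClosed_of_mem_componentsOf isClosed_closure (hC V.2)) (fun V => (hC V.2).1.1)
    (by rwa [← Set.sInter_eq_iInter]) hη (fun V => x (c (e (some V)))) (fun V => hcx (e (some V)))
  rw [hx.2] at hdim
  have : n ≤ Nat.card C := by exact_mod_cast hdim
  omega

end Morphisms

end SncPairs

theorem mainTheorem7 {k : Type u} [Field k] [CharZero k] {X Y : Scheme.{u}}
    (sX : X ⟶ Spec (.of k)) (sY : Y ⟶ Spec (.of k)) (f : Y ⟶ X) (D : Set X)
    (hXD : SncPairs.IsReducedPair sX D) (hf : SncPairs.IsLogResolution sX sY f D) :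
    SncPairs.SatisfiesCondition2 f D ∧
      ∀ Z ∈ SncPairs.strata (SncPairs.birationalTransform f D),
        ¬ Z ⊆ SncPairs.exceptionalLocus f := by
  have := hXD.isVariety.isIntegral
  have := hf.isVariety.isIntegral
  have := hf.isVariety.locallyOfFiniteType
  have := hf.isVariety.quasiCompact
  have : IsLocallyNoetherian Y := LocallyOfFiniteType.isLocallyNoetherian sY
  have : CompactSpace Y := QuasiCompact.compactSpace_of_compactSpace sY
  have : IsNoetherian Y := {}
  have h : SncPairs.SatisfiesCondition2 f D :=
    SncPairs.satisfiesCondition2_of_isSNC hXD.isReducedDivisor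
      hf.isReducedDivisor_exceptionalLocus hf.isSNC_add
  refine ⟨h, fun Z hZ hZE => ?_⟩
  have ⟨C, hC, hZC⟩ := hZ
  obtain ⟨η, hη⟩ := QuasiSober.sober hZC.1.1 (SncPairs.isClosed_of_mem_componentsOf
    (isClosed_sInter fun V hV => SncPairs.isClosed_of_mem_componentsOf isClosed_closure (hC hV)) hZC)
  exact hZE hη.mem (h Z hZ η hη)
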